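/- Let $a,b\in\mathbb{Z}$ be square-free integers with $a\equiv 1\pmod 4$, and let $L=\mathbb{Q}(\sqrt a,\sqrt b)$ be a biquadratic extension of $\mathbb{Q}$, that is $[L:\mathbb{Q}]=4$. Put $G=\mathrm{Gal}(L/\mathbb{Q})\cong C_2\times C_2$ and let $\mathcal{O}_L$ be the ring of integers of $L$. A Hopf-Galois structure on $L/\mathbb{Q}$ is a finite-dimensional cocommutative $\mathbb{Q}$-Hopf algebra $H$ with a $\mathbb{Q}$-linear action on $L$ that makes $L$ a left $H$-module algebra and such that $j\colon L\otimes_{\mathbb{Q}}H\to\mathrm{End}_{\mathbb{Q}}(L)$, $j(x\otimes h)(y)=x(h\cdot y)$, is bijective. Its associated order is $\mathfrak{A}_H=\{h\in H : h\cdot\mathcal{O}_L\subseteq\mathcal{O}_L\}$. Let $\tau$ be the non-trivial element of $G$ that fixes $\sqrt a$, let $\sigma\in G$ with $\sigma(\sqrt a)\neq\sqrt a$, and let $N=\langle\mu,\eta\rangle\le\mathrm{Perm}(G)$, where $\mu$ is the left translation by $\tau$ and $\eta$ is the $4$-cycle $(1_G,\sigma\tau,\tau,\sigma)$; $N$ does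 not depend on the choice of $\sigma$. The non-classical Hopf-Galois structure of $L/\mathbb{Q}$ given by $\sqrt a$ is (up to isomorphism of Hopf-Galois structures) $H=L[N]^G$, where $G$ acts on $L$ by the Galois action and on $N$ by conjugation with left translations, and $H$ acts on $L$ by $\bigl(\sum_{n\in N}c_n n\bigr)\cdot x=\sum_{n\in N}c_n\,n^{-1}(1_G)(x)$. It has the $\mathbb{Q}$-basis $\{\mathrm{Id},\mu,\eta+\mu\eta,\sqrt a(\eta-\mu\eta)\}$. Let $H$ be the non-classical Hopf-Galois structure of $L/\mathbb{Q}$ given by $\sqrt a$. If $a>1$, then $\mathcal{O}_L$ is not free as an $\mathfrak{A}_H$-module. -/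

import Mathlib

open scoped TensorProduct IntermediateField

namespace HopfGaloisTheory

section HopfGaloisStructures

variable (K L H : Type*) [Field K] [Field L] [Algebra K L] [Ring H] [HopfAlgebra K H]
  [Module H L] [IsScalarTower K H L]

/-- The canonical `K`-linear map `j : L ⊗[K] H → End_K(L)`, `j (x ⊗ h) y = x * (h • y)`. -/
noncomputable def galoisMap : L ⊗[K] H →ₗ[K] Module.End K L :=
  TensorProduct.lift ((LinearMap.mul K (Module.End K L)).compl₁₂
    (Algebra.lmul K L).toLinearMap (Algebra.lsmul K K L : H →ₐ[K] Module.End K L).toLinearMap)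

theorem galoisMap_tmul (x : L) (h : H) (y : L) :
    galoisMap K L H (x ⊗ₜ h) y = x * (h • y) := rfl

/-- For `x : L`, the `K`-linear map `H → L`, `h ↦ h • x`. -/
noncomputable def actOn (x : L) : H →ₗ[K] L :=
  (Algebra.lsmul K K L : H →ₐ[K] Module.End K L).toLinearMap.flip x

theorem actOn_apply (x : L) (h : H) : actOn K L H x h = h • x := rfl

/-- A `K`-Hopf algebra `H` acting `K`-linearly on the field `L` is a Hopf-Galois structure on
`L / K`: it is finite-dimensional and cocommutative, `L` is a left `H`-module algebra, that is
`h • 1 = ε(h)` and `h • (x * y) = ∑ (h₁ • x) * (h₂ • y)` where `Δ(h) = ∑ h₁ ⊗ h₂`, and the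
canonical map `j : L ⊗ H → End_K(L)` is bijective. -/
class IsHopfGalois : Prop where
  finite : Module.Finite K H
  cocomm : Coalgebra.IsCocomm K H
  smul_one : ∀ h : H, h • (1 : L) = algebraMap K L (Coalgebra.counit h)
  smul_mul : ∀ (h : H) (x y : L), h • (x * y) =
    LinearMap.mul' K L
      (TensorProduct.map (actOn K L H x) (actOn K L H y) (Coalgebra.comul (R := K) h))
  bijective : Function.Bijective (galoisMap K L H)

end HopfGaloisStructures

section GreitherPareigis

variable (K L : Type*) [Field K] [Field L] [Algebra K L]

/-- The Galois group `G` of `L / K`. -/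
abbrev Gal : Type _ := L ≃ₐ[K] L

/-- The left translation `λ : G → Perm(G)`. -/
def leftTranslation : Gal K L →* Equiv.Perm (Gal K L) :=
  MulAction.toPermHom (Gal K L) (Gal K L)

/-- The action of `g ∈ G` on `L[Perm(G)]`: through the Galois action on the coefficients and
through conjugation by `λ(g)` on the permutations. -/
noncomputable def galAct (g : Gal K L) :
    MonoidAlgebra L (Equiv.Perm (Gal K L)) →ₐ[K] MonoidAlgebra L (Equiv.Perm (Gal K L)) :=
  (MonoidAlgebra.mapAlgHom _ (g : L →ₐ[K] L)).comp
    (MonoidAlgebra.mapDomainAlgHom K L (MulAut.conj (leftTranslation K L g)).toMonoidHom)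

/-- The fixed algebra `L[N]^G`, for a subgroup `N` of `Perm(G)` normalized by `λ(G)`, where the
group algebra `L[N]` is regarded inside `L[Perm(G)]`. -/
noncomputable def fixedAlgebra (N : Subgroup (Equiv.Perm (Gal K L))) :
    Subalgebra K (MonoidAlgebra L (Equiv.Perm (Gal K L))) :=
  (MonoidAlgebra.mapDomainAlgHom K L N.subtype).range ⊓
    ⨅ g : Gal K L, AlgHom.equalizer (galAct K L g) (AlgHom.id K _)

variable {K L} in
/-- The Greither-Pareigis action `(∑ c_η η) · x = ∑ c_η η⁻¹(1_G)(x)`. -/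
noncomputable def permAct (f : MonoidAlgebra L (Equiv.Perm (Gal K L))) (x : L) : L :=
  f.coeff.sum fun η c => c * (η⁻¹ 1) x

end GreitherPareigis

section Biquadratic

variable {K L : Type*} [Field K] [Field L] [Algebra K L]

open Classical in
/-- The subgroup `N_{T,1} = ⟨μ, η⟩` of `Perm(G)`, where `T = ⟨τ⟩`, `μ = λ(τ)` and `η` is the
cycle `(1, στ, τ, σ)` (for `G` elementary abelian of order `4` generated by `σ` and `τ`). -/
noncomputable def cyclicSubgroup (σ τ : Gal K L) : Subgroup (Equiv.Perm (Gal K L)) :=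
  Subgroup.closure {leftTranslation K L τ, List.formPerm [1, σ * τ, τ, σ]}

/-- For a biquadratic extension `L / K` and `z ∈ L` with `z ∉ K` and `z ^ 2 ∈ K`: the Hopf-Galois
structure `H` is (isomorphic to) the non-classical Hopf-Galois structure given by `z`, that is to
`L[N_{T,1}]^G` with the Greither-Pareigis action, where `T = ⟨τ⟩` is the group of `L / K(z)` and
`σ ∈ G - T`. The two choices of `σ` give the same subgroup `N_{T,1}`.
An isomorphism of algebras that respects the actions on `L` also respects the coalgebra
structures, since in a Hopf-Galois structure the latter are determined by the action. -/
def IsGivenBy (K : Type*) {L : Type*} (H : Type*) [Field K] [Field L] [Algebra K L] [Ring H]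
    [Algebra K H] [Module H L] (z : L) : Prop :=
  ∃ σ τ : Gal K L, τ ≠ 1 ∧ τ z = z ∧ σ z ≠ z ∧
    ∃ e : H ≃ₐ[K] fixedAlgebra K L (cyclicSubgroup σ τ),
      ∀ (h : H) (x : L), h • x = permAct (e h : MonoidAlgebra L (Equiv.Perm (Gal K L))) x

end Biquadratic

section AssociatedOrder

variable (L H : Type*) [Field L] [Ring H] [Module H L]

/-- The associated order `𝔄_H = {h ∈ H | h · O_L ⊆ O_L}` of `O_L` in `H`, where `O_L` is the
integral closure of `ℤ` in `L`. -/
def associatedOrder : Subring H where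
  carrier := {h | ∀ x ∈ integralClosure ℤ L, h • x ∈ integralClosure ℤ L}
  mul_mem' {a b} ha hb x hx := by
    rw [mul_smul]
    exact ha _ (hb x hx)
  one_mem' x hx := by rwa [one_smul]
  add_mem' {a b} ha hb x hx := by
    rw [add_smul]
    exact add_mem (ha x hx) (hb x hx)
  zero_mem' x _ := by
    rw [zero_smul]
    exact zero_mem _
  neg_mem' {a} ha x hx := by
    rw [neg_smul]
    exact neg_mem (ha x hx)

/-- The ring of integers `O_L`, as a module over the associated order `𝔄_H`. -/
def integersModule : Submodule (associatedOrder L H) L where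
  carrier := {x | x ∈ integralClosure ℤ L}
  add_mem' {a b} ha hb := (integralClosure ℤ L).add_mem ha hb
  zero_mem' := zero_mem (integralClosure ℤ L)
  smul_mem' h _ hx := h.2 _ hx

end AssociatedOrder

end HopfGaloisTheory

open scoped TensorProduct IntermediateField

namespace HopfGaloisTheory

/-! ### Coordinates of `L` over `ℚ` with respect to `1, α, β, αβ`. -/

section Coordinates

variable {L : Type*} [Field L] [NumberField L] {a b : ℤ} {α β : L}

/-! Write `d = gcd(a, b)`, `a = de`, `b = df` and `γ = αβ/d`. The map `y ↦ y - τ y` projects `L`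
onto the `(-1)`-eigenspace of `τ`, the plane spanned by `β` and `γ`. There `η + μη` acts as zero,
`μ` acts as `-1`, and `α(η - μη)` acts, up to sign, as twice the operator `β ↦ dγ`, `γ ↦ -eβ`, whose
square is `-a`. So `H` acts on this plane through `ℚ(√(-a))`, an imaginary quadratic field when `a >
1`.

The image of `O_L` is the lattice `M = ℤ sβ + ℤ s(β + γ)/2` with `s = 1` or `s = 2` according to `b`
modulo `4` (`isLattice_of_modEq_one`, `isLattice_of_modEq_two_or_three`). An element of `𝔄_H`
preserves `M`, which forces it to act through `ℤ[√(-a)]` (`exists_int_of_preserves`).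

Freeness would mean rank one (`exists_generator_of_free`), so some `x ∈ O_L` would have a projection
generating `M` over `ℤ[√(-a)]`. If this projection is `s(uβ + wγ)/2`, with `u ≡ w` modulo `2`, a
determinant comparison shows that the positive definite form `du² + ew²` divides `2`. The parity
condition and `de > 1` exclude this (`not_represents`). -/

theorem exists_coordinates (hα : α ^ 2 = (a : L)) (hβ : β ^ 2 = (b : L)) (hL : ℚ⟮α, β⟯ = ⊤)
    (y : L) : ∃ x₀ x₁ x₂ x₃ : ℚ, y = x₀ + x₁ * α + x₂ * β + x₃ * (α * β) := by
  have hy : y ∈ Algebra.adjoin ℚ ({α, β} : Set L) := by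
    have h := IntermediateField.adjoin_toSubalgebra_of_isAlgebraic (F := ℚ) (E := L)
      (S := {α, β}) fun x _ => Algebra.IsAlgebraic.isAlgebraic x
    rw [← h, hL]
    trivial
  induction hy using Algebra.adjoin_induction with
  | mem x hx =>
    rcases hx with rfl | rfl
    · exact ⟨0, 1, 0, 0, by simp⟩
    · exact ⟨0, 0, 1, 0, by simp⟩
  | algebraMap r => exact ⟨r, 0, 0, 0, by simp⟩
  | add x y _ _ hx hy =>
    obtain ⟨x₀, x₁, x₂, x₃, rfl⟩ := hx
    obtain ⟨y₀, y₁, y₂, y₃, rfl⟩ := hy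
    exact ⟨x₀ + y₀, x₁ + y₁, x₂ + y₂, x₃ + y₃, by push_cast; ring⟩
  | mul x y _ _ hx hy =>
    obtain ⟨x₀, x₁, x₂, x₃, rfl⟩ := hx
    obtain ⟨y₀, y₁, y₂, y₃, rfl⟩ := hy
    refine ⟨x₀ * y₀ + a * x₁ * y₁ + b * x₂ * y₂ + a * b * x₃ * y₃,
      x₀ * y₁ + x₁ * y₀ + b * (x₂ * y₃ + x₃ * y₂),
      x₀ * y₂ + x₂ * y₀ + a * (x₁ * y₃ + x₃ * y₁),
      x₀ * y₃ + x₃ * y₀ + x₁ * y₂ + x₂ * y₁, ?_⟩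
    push_cast
    rw [← hα, ← hβ]
    ring

theorem coordinates_eq_zero (hdeg : Module.finrank ℚ L = 4)
    (hα : α ^ 2 = (a : L)) (hβ : β ^ 2 = (b : L)) (hL : ℚ⟮α, β⟯ = ⊤) {x₀ x₁ x₂ x₃ : ℚ}
    (h : (x₀ + x₁ * α + x₂ * β + x₃ * (α * β) : L) = 0) :
    x₀ = 0 ∧ x₁ = 0 ∧ x₂ = 0 ∧ x₃ = 0 := by
  have hli : LinearIndependent ℚ ![1, α, β, α * β] := by
    refine linearIndependent_of_top_le_span_of_card_eq_finrank ?_ (by simp [hdeg])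
    rintro y -
    obtain ⟨y₀, y₁, y₂, y₃, rfl⟩ := exists_coordinates hα hβ hL y
    rw [Submodule.mem_span_range_iff_exists_fun]
    exact ⟨![y₀, y₁, y₂, y₃], by simp [Fin.sum_univ_four, Algebra.smul_def]⟩
  have := Fintype.linearIndependent_iff.1 hli ![x₀, x₁, x₂, x₃]
    (by simpa [Fin.sum_univ_four, Algebra.smul_def] using h)
  exact ⟨this 0, this 1, this 2, this 3⟩

theorem coordinates_unique (hdeg : Module.finrank ℚ L = 4)
    (hα : α ^ 2 = (a : L)) (hβ : β ^ 2 = (b : L)) (hL : ℚ⟮α, β⟯ = ⊤)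
    {x₀ x₁ x₂ x₃ y₀ y₁ y₂ y₃ : ℚ}
    (h : (x₀ + x₁ * α + x₂ * β + x₃ * (α * β) : L) = y₀ + y₁ * α + y₂ * β + y₃ * (α * β)) :
    x₀ = y₀ ∧ x₁ = y₁ ∧ x₂ = y₂ ∧ x₃ = y₃ := by
  have := coordinates_eq_zero hdeg hα hβ hL (x₀ := x₀ - y₀) (x₁ := x₁ - y₁) (x₂ := x₂ - y₂)
    (x₃ := x₃ - y₃) (by push_cast; linear_combination h)
  simpa only [sub_eq_zero] using this

theorem algEquiv_ext (hα : α ^ 2 = (a : L)) (hβ : β ^ 2 = (b : L)) (hL : ℚ⟮α, β⟯ = ⊤)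
    {g h : Gal ℚ L} (h₁ : g α = h α) (h₂ : g β = h β) : g = h := by
  ext y
  obtain ⟨x₀, x₁, x₂, x₃, rfl⟩ := exists_coordinates hα hβ hL y
  simp [h₁, h₂]

theorem apply_eq_or_neg {n : ℤ} {z : L} (hz : z ^ 2 = (n : L)) (g : Gal ℚ L) :
    g z = z ∨ g z = -z := by
  rw [← sq_eq_sq_iff_eq_or_eq_neg, ← map_pow, hz, map_intCast]

end Coordinates

/-! ### The cyclic group `⟨μ, η⟩` and the coefficients of elements of `L[N]^G`. -/

section CyclicSubgroup

variable {K L : Type*} [Field K] [Field L] [Algebra K L] {σ τ : Gal K L}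

open Classical in
/-- The `4`-cycle `(1, στ, τ, σ)`. -/
noncomputable def fourCycle (σ τ : Gal K L) : Equiv.Perm (Gal K L) :=
  List.formPerm [1, σ * τ, τ, σ]

/-- `G` is the Klein four-group generated by `σ` and `τ`. -/
structure IsKleinPair (σ τ : Gal K L) : Prop where
  sq_left : σ * σ = 1
  sq_right : τ * τ = 1
  comm : τ * σ = σ * τ
  left_ne : σ ≠ 1
  right_ne : τ ≠ 1
  ne : σ ≠ τ
  cover : ∀ g : Gal K L, g = 1 ∨ g = σ * τ ∨ g = τ ∨ g = σ

namespace IsKleinPair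

theorem mul_ne (h : IsKleinPair σ τ) : σ * τ ≠ 1 := fun H =>
  h.ne (by rw [← mul_one σ, ← h.sq_right, ← mul_assoc, H, one_mul])

theorem fourCycle_one (h : IsKleinPair σ τ) : fourCycle σ τ 1 = σ * τ := by
  have := h.left_ne
  have := h.right_ne
  have := h.ne
  have := h.mul_ne
  simp_all [fourCycle, Equiv.swap_apply_def, eq_comm]

theorem fourCycle_mul (h : IsKleinPair σ τ) : fourCycle σ τ (σ * τ) = τ := by
  have := h.left_ne
  have := h.right_ne
  have := h.ne
  have := h.mul_ne
  simp_all [fourCycle, Equiv.swap_apply_def]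

theorem fourCycle_right (h : IsKleinPair σ τ) : fourCycle σ τ τ = σ := by
  have := h.left_ne
  have := h.right_ne
  have := h.ne
  have := h.mul_ne
  simp_all [fourCycle, Equiv.swap_apply_def]

theorem fourCycle_left (h : IsKleinPair σ τ) : fourCycle σ τ σ = 1 := by
  have := h.left_ne
  have := h.right_ne
  have := h.ne
  have := h.mul_ne
  simp_all [fourCycle]

theorem mul_left_mul (h : IsKleinPair σ τ) (g : Gal K L) : σ * (σ * g) = g := by
  rw [← mul_assoc, h.sq_left, one_mul]

theorem comm_mul (h : IsKleinPair σ τ) (g : Gal K L) : τ * (σ * g) = σ * (τ * g) := by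
  rw [← mul_assoc, h.comm, mul_assoc]

theorem fourCycle_sq (h : IsKleinPair σ τ) :
    fourCycle σ τ * fourCycle σ τ = leftTranslation K L τ := by
  ext1 g
  rcases h.cover g with rfl | rfl | rfl | rfl <;>
    simp [leftTranslation, h.fourCycle_one, h.fourCycle_mul, h.fourCycle_left, h.fourCycle_right,
      h.comm, h.comm_mul, h.sq_right]

theorem conj_right_fourCycle (h : IsKleinPair σ τ) :
    leftTranslation K L τ * fourCycle σ τ = fourCycle σ τ * leftTranslation K L τ := by
  rw [← h.fourCycle_sq, mul_assoc]

/-- Conjugation by `λ(σ)` inverts `η`, since `μη = η⁻¹`. This is why the coefficients of a fixed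
element at `η` and `μη` are conjugate under `σ`. -/
theorem conj_left_fourCycle (h : IsKleinPair σ τ) :
    leftTranslation K L σ * fourCycle σ τ =
      leftTranslation K L τ * fourCycle σ τ * leftTranslation K L σ := by
  ext1 g
  rcases h.cover g with rfl | rfl | rfl | rfl <;>
    simp [leftTranslation, h.fourCycle_one, h.fourCycle_mul, h.fourCycle_left, h.fourCycle_right,
      h.comm, h.sq_right, h.sq_left, h.mul_left_mul, h.comm_mul]

theorem mem_cyclicSubgroup (h : IsKleinPair σ τ) {n : Equiv.Perm (Gal K L)}
    (hn : n ∈ cyclicSubgroup σ τ) :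
    n = 1 ∨ n = leftTranslation K L τ ∨ n = fourCycle σ τ ∨
      n = leftTranslation K L τ * fourCycle σ τ := by
  have hμ : leftTranslation K L τ * leftTranslation K L τ = 1 := by
    rw [← map_mul, h.sq_right, map_one]
  have hμ' (g : Equiv.Perm (Gal K L)) :
      leftTranslation K L τ * (leftTranslation K L τ * g) = g := by
    rw [← mul_assoc, hμ, one_mul]
  have hη := h.fourCycle_sq
  have hc := h.conj_right_fourCycle.symm
  have hc' (g : Equiv.Perm (Gal K L)) :
      fourCycle σ τ * (leftTranslation K L τ * g) = leftTranslation K L τ * (fourCycle σ τ * g) := by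
    rw [← mul_assoc, hc, mul_assoc]
  have hμi : (leftTranslation K L τ)⁻¹ = leftTranslation K L τ := inv_eq_of_mul_eq_one_left hμ
  have hηi : (fourCycle σ τ)⁻¹ = leftTranslation K L τ * fourCycle σ τ :=
    inv_eq_of_mul_eq_one_left (by rw [mul_assoc, hη, hμ])
  induction hn using Subgroup.closure_induction with
  | mem x hx =>
    rcases hx with rfl | rfl
    · simp
    · exact .inr (.inr (.inl rfl))
  | one => simp
  | mul x y _ _ hx hy =>
    rcases hx with rfl | rfl | rfl | rfl <;> rcases hy with rfl | rfl | rfl | rfl <;>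
      simp [mul_assoc, hμ, hμ', hη, hc, hc']
  | inv x _ hx =>
    rcases hx with rfl | rfl | rfl | rfl <;> simp [hμi, hηi, mul_assoc, hc, hμ']

theorem distinct (h : IsKleinPair σ τ) :
    (1 : Equiv.Perm (Gal K L)) ≠ leftTranslation K L τ ∧
    (1 : Equiv.Perm (Gal K L)) ≠ fourCycle σ τ ∧
    (1 : Equiv.Perm (Gal K L)) ≠ leftTranslation K L τ * fourCycle σ τ ∧
    leftTranslation K L τ ≠ fourCycle σ τ ∧
    leftTranslation K L τ ≠ leftTranslation K L τ * fourCycle σ τ ∧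
    fourCycle σ τ ≠ leftTranslation K L τ * fourCycle σ τ := by
  refine ⟨?_, ?_, ?_, ?_, ?_, ?_⟩ <;> intro H <;> have H := DFunLike.congr_fun H 1 <;>
    simp [leftTranslation, h.fourCycle_one, h.comm_mul, h.sq_right, h.left_ne, h.right_ne,
      h.left_ne.symm, h.right_ne.symm, h.mul_ne.symm, h.ne.symm] at H

theorem permAct_eq (h : IsKleinPair σ τ) {f : MonoidAlgebra L (Equiv.Perm (Gal K L))}
    (hf : f ∈ fixedAlgebra K L (cyclicSubgroup σ τ)) (x : L) :
    permAct f x = f.coeff 1 * x + f.coeff (leftTranslation K L τ) * τ x +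
      (f.coeff (fourCycle σ τ) * σ x +
        f.coeff (leftTranslation K L τ * fourCycle σ τ) * σ (τ x)) := by
  classical
  obtain ⟨⟨f', hf'⟩, -⟩ := hf
  have hs : f.coeff.support ⊆ {1, leftTranslation K L τ, fourCycle σ τ,
      leftTranslation K L τ * fourCycle σ τ} := by
    intro n hn
    have hn' : n ∈ cyclicSubgroup σ τ := by
      subst hf'
      obtain ⟨m, -, rfl⟩ := Finset.mem_image.1 (Finsupp.mapDomain_support hn)
      exact m.2
    simpa using h.mem_cyclicSubgroup hn'
  have hμ : (leftTranslation K L τ)⁻¹ 1 = τ := by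
    rw [Equiv.Perm.inv_eq_iff_eq]
    simp [leftTranslation, h.sq_right]
  have hη : (fourCycle σ τ)⁻¹ 1 = σ := by
    rw [Equiv.Perm.inv_eq_iff_eq, h.fourCycle_left]
  have hμη : (leftTranslation K L τ * fourCycle σ τ)⁻¹ 1 = σ * τ := by
    rw [Equiv.Perm.inv_eq_iff_eq, Equiv.Perm.mul_apply, h.fourCycle_mul]
    simp [leftTranslation, h.sq_right]
  obtain ⟨h₁, h₂, h₃, h₄, h₅, h₆⟩ := h.distinct
  rw [permAct, Finsupp.sum_of_support_subset _ hs _ (by simp), Finset.sum_insert (by simp [*]),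
    Finset.sum_insert (by simp [*]), Finset.sum_pair h₆, hμ, hη, hμη]
  simp [add_assoc]

/-- Invariance under `g` read off one coefficient at a time: conjugation by `λ(g)` moves the index
and `g` moves the coefficient. -/
theorem coeff_conj {N : Subgroup (Equiv.Perm (Gal K L))}
    {f : MonoidAlgebra L (Equiv.Perm (Gal K L))} (hf : f ∈ fixedAlgebra K L N) (g : Gal K L)
    {m n : Equiv.Perm (Gal K L)} (hmn : leftTranslation K L g * n = m * leftTranslation K L g) :
    f.coeff m = g (f.coeff n) := by
  have hfg : galAct K L g f = f := (Algebra.mem_iInf.1 hf.2) g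
  have hm : m = MulAut.conj (leftTranslation K L g) n := by
    rw [MulAut.conj_apply, hmn, mul_inv_cancel_right]
  conv_lhs => rw [← hfg, hm]
  simp only [galAct, AlgHom.comp_apply, MonoidAlgebra.coeff_mapAlgHom]
  exact congrArg g <| Finsupp.mapDomain_apply (f := MulAut.conj (leftTranslation K L g))
    (MulAut.conj (leftTranslation K L g)).injective f.coeff n

end IsKleinPair

end CyclicSubgroup

/-! ### The action of `H` on `L` in explicit form. -/

section Action

variable {L : Type*} [Field L] [NumberField L] {a b : ℤ} {α β : L}

/-- An automorphism is determined by its signs on `α` and `β`. Hence only `1` and `τ` fix `α`, and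
multiplication by `σ` carries the remaining automorphisms to these. -/
theorem isKleinPair (hα : α ^ 2 = (a : L)) (hβ : β ^ 2 = (b : L)) (hL : ℚ⟮α, β⟯ = ⊤)
    {σ τ : Gal ℚ L} (hτ : τ ≠ 1) (hτα : τ α = α) (hσα : σ α ≠ α) : IsKleinPair σ τ := by
  have hσα' : σ α = -α := (apply_eq_or_neg hα σ).resolve_left hσα
  have hτβ : τ β = -β := (apply_eq_or_neg hβ τ).resolve_left fun H =>
    hτ (algEquiv_ext hα hβ hL hτα H)
  have fix (g : Gal ℚ L) (hg : g α = α) : g = 1 ∨ g = τ := by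
    rcases apply_eq_or_neg hβ g with H | H
    · exact .inl (algEquiv_ext hα hβ hL hg H)
    · exact .inr (algEquiv_ext hα hβ hL (by rw [hg, hτα]) (by rw [H, hτβ]))
  have h₁ : σ * σ = 1 := by
    refine algEquiv_ext hα hβ hL (by simp [hσα']) ?_
    rcases apply_eq_or_neg hβ σ with H | H <;> simp [H]
  refine ⟨h₁, algEquiv_ext hα hβ hL (by simp [hτα]) (by simp [hτβ]),
    algEquiv_ext hα hβ hL (by simp [hτα, hσα']) ?_, ?_, hτ, ?_, fun g => ?_⟩
  · rcases apply_eq_or_neg hβ σ with H | H <;> simp [H, hτβ]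
  · rintro rfl
    exact hσα rfl
  · rintro rfl
    exact hσα hτα
  · rcases apply_eq_or_neg hα g with H | H
    · rcases fix g H with h | h <;> simp [h]
    · have hg : g = σ * (σ * g) := by rw [← mul_assoc, h₁, one_mul]
      rcases fix (σ * g) (by simp [H, hσα']) with h | h <;> rw [hg, h] <;> simp

/-- The action of the non-classical Hopf-Galois structure given by `α`, in coordinates with respect
to `Id, μ, η + μη, α(η - μη)`. -/
theorem IsGivenBy.exists_smul_eq (hdeg : Module.finrank ℚ L = 4) (hα : α ^ 2 = (a : L))
    (hβ : β ^ 2 = (b : L)) (hL : ℚ⟮α, β⟯ = ⊤) {H : Type*} [Ring H] [Algebra ℚ H] [Module H L]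
    (hH : IsGivenBy ℚ H α) :
    ∃ ρ τ : Gal ℚ L, ρ α = -α ∧ ρ β = β ∧ τ α = α ∧ τ β = -β ∧
      ∀ h : H, ∃ c₀ c₁ c₂ c₃ : ℚ, ∀ x : L,
        h • x = c₀ * x + c₁ * τ x + c₂ * (ρ x + ρ (τ x)) + c₃ * α * (ρ x - ρ (τ x)) := by
  obtain ⟨σ, τ, hτ, hτα, hσα, e, he⟩ := hH
  have hk := isKleinPair hα hβ hL hτ hτα hσα
  have hσα' : σ α = -α := (apply_eq_or_neg hα σ).resolve_left hσα
  have hτβ : τ β = -β := (apply_eq_or_neg hβ τ).resolve_left fun H =>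
    hτ (algEquiv_ext hα hβ hL hτα H)
  -- `ρ` is whichever of `σ`, `στ` fixes `β`. In the second case the roles of `η` and `μη` are
  -- exchanged, which later changes the sign of `c₃`.
  have hρ : ∃ ρ : Gal ℚ L, ρ α = -α ∧ ρ β = β ∧
      ((∀ x, σ x = ρ x ∧ σ (τ x) = ρ (τ x)) ∨ (∀ x, σ x = ρ (τ x) ∧ σ (τ x) = ρ x)) := by
    rcases apply_eq_or_neg hβ σ with h | h
    · exact ⟨σ, hσα', h, .inl fun x => ⟨rfl, rfl⟩⟩
    · refine ⟨σ * τ, by simp [hτα, hσα'], by simp [hτβ, h], .inr fun x => ⟨?_, rfl⟩⟩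
      rw [← AlgEquiv.mul_apply, mul_assoc, hk.sq_right, mul_one]
  have hfixτ (c : L) (hc : τ c = c) : ∃ x₀ x₁ : ℚ, c = x₀ + x₁ * α := by
    obtain ⟨x₀, x₁, x₂, x₃, rfl⟩ := exists_coordinates hα hβ hL c
    simp only [map_add, map_mul, map_ratCast, hτα, hτβ] at hc
    obtain ⟨-, -, h₂, h₃⟩ := coordinates_eq_zero hdeg hα hβ hL (x₀ := 0) (x₁ := 0)
      (x₂ := x₂) (x₃ := x₃) (by push_cast; linear_combination (-1 / 2 : L) * hc)
    exact ⟨x₀, x₁, by simp [h₂, h₃]⟩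
  have hfix (c : L) (hc : τ c = c) (hc' : σ c = c) : ∃ x₀ : ℚ, c = x₀ := by
    obtain ⟨x₀, x₁, rfl⟩ := hfixτ c hc
    simp only [map_add, map_mul, map_ratCast, hσα'] at hc'
    obtain ⟨-, h₁, -, -⟩ := coordinates_eq_zero hdeg hα hβ hL (x₀ := 0) (x₁ := x₁)
      (x₂ := 0) (x₃ := 0) (by push_cast; linear_combination (-1 / 2 : L) * hc')
    exact ⟨x₀, by simp [h₁]⟩
  obtain ⟨ρ, hρα, hρβ, hρ⟩ := hρ
  refine ⟨ρ, τ, hρα, hρβ, hτα, hτβ, fun h => ?_⟩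
  have hf := (e h).2
  set f := (e h).1 with hfdef
  obtain ⟨c₀, hc₀⟩ := hfix (f.coeff 1)
    (IsKleinPair.coeff_conj hf τ (by simp)).symm (IsKleinPair.coeff_conj hf σ (by simp)).symm
  obtain ⟨c₁, hc₁⟩ := hfix (f.coeff (leftTranslation ℚ L τ))
    (IsKleinPair.coeff_conj hf τ rfl).symm
    (IsKleinPair.coeff_conj hf σ (by rw [← map_mul, ← map_mul, hk.comm])).symm
  obtain ⟨c₂, c₃, hc₂⟩ := hfixτ (f.coeff (fourCycle σ τ))
    (IsKleinPair.coeff_conj hf τ hk.conj_right_fourCycle).symm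
  have hc₃ := IsKleinPair.coeff_conj hf σ hk.conj_left_fourCycle
  rw [hc₂] at hc₃
  simp only [map_add, map_mul, map_ratCast, hσα'] at hc₃
  rcases hρ with hρ | hρ
  · refine ⟨c₀, c₁, c₂, c₃, fun x => ?_⟩
    rw [he, ← hfdef, hk.permAct_eq hf, hc₀, hc₁, hc₂, hc₃, (hρ x).1, (hρ x).2]
    ring
  · refine ⟨c₀, c₁, c₂, -c₃, fun x => ?_⟩
    rw [he, ← hfdef, hk.permAct_eq hf, hc₀, hc₁, hc₂, hc₃, (hρ x).1, (hρ x).2]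
    push_cast
    ring

end Action

/-! ### Freeness forces a single generator. -/

section Generator

/-- Bijectivity of `j` equates the dimensions of `L ⊗ H` and `End_K(L)`; cancel one factor `[L :
K]`. -/
theorem finrank_eq_of_isHopfGalois (K L H : Type*) [Field K] [Field L] [Algebra K L]
    [FiniteDimensional K L] [Ring H] [HopfAlgebra K H] [Module H L] [IsScalarTower K H L]
    [IsHopfGalois K L H] : Module.finrank K H = Module.finrank K L := by
  have h := (LinearEquiv.ofBijective (galoisMap K L H) IsHopfGalois.bijective).finrank_eq
  rw [Module.finrank_tensorProduct, Module.finrank_linearMap] at h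
  exact Nat.eq_of_mul_eq_mul_left Module.finrank_pos h

/-- If every element of `H` has a multiple in the associated order, a free ring of integers is
generated by one element. -/
theorem exists_generator_of_free {L : Type*} [Field L] [NumberField L]
    {H : Type*} [Ring H] [HopfAlgebra ℚ H] [Module H L] [IsScalarTower ℚ H L] [IsHopfGalois ℚ L H]
    (hden : ∀ h : H, ∃ n : ℤ, n ≠ 0 ∧ n • h ∈ associatedOrder L H)
    (hfree : Module.Free (associatedOrder L H) (integersModule L H)) :
    ∃ x ∈ integralClosure ℤ L, ∀ y ∈ integralClosure ℤ L, ∃ h ∈ associatedOrder L H, y = h • x := by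
  have : Module.Finite ℚ H := IsHopfGalois.finite L
  obtain ⟨⟨ι, B⟩⟩ := hfree
  have hH := finrank_eq_of_isHopfGalois ℚ L H
  let w := Module.finBasis ℚ H
  choose n hn hw using fun i => hden (w i)
  have hli : LinearIndependent ℤ fun i => (⟨n i • w i, hw i⟩ : associatedOrder L H) := by
    have h₁ : LinearIndependent ℚ fun i => n i • w i := by
      have := w.linearIndependent.units_smul fun i => Units.mk0 (n i : ℚ) (by exact_mod_cast hn i)
      convert this using 2 with i
      exact (Int.cast_smul_eq_zsmul ℚ (n i) (w i)).symm
    have h₂ := (LinearIndependent.iff_fractionRing ℤ ℚ).2 h₁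
    exact LinearIndependent.of_comp (associatedOrder L H).subtype.toIntAlgHom.toLinearMap h₂
  -- Multiplying a `ℚ`-basis of `H`, scaled into the associated order, by a basis of `O_L` gives a
  -- `ℚ`-independent family in `L`. Since `dim H = dim L`, the second basis has at most one element.
  have hli' := linearIndependent_smul hli B.linearIndependent
  have hli'' : LinearIndependent ℤ fun p : Fin (Module.finrank ℚ H) × ι =>
      (((⟨n p.1 • w p.1, hw p.1⟩ : associatedOrder L H) • B p.2 : integersModule L H) : L) :=
    hli'.map' ((integersModule L H).subtype.restrictScalars ℤ)
      (LinearMap.ker_eq_bot.2 Subtype.val_injective)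
  have hli3 := (LinearIndependent.iff_fractionRing ℤ ℚ).1 hli''
  have hfin := hli3.finite
  have hpos : 0 < Module.finrank ℚ L := Module.finrank_pos
  have : Nonempty (Fin (Module.finrank ℚ H)) := ⟨⟨0, by omega⟩⟩
  have : Finite ι := Finite.prod_right (Fin (Module.finrank ℚ H))
  have := Fintype.ofFinite ι
  have hcard := hli3.fintype_card_le_finrank
  rw [Fintype.card_prod, Fintype.card_fin, hH] at hcard
  have hι : Subsingleton ι := Fintype.card_le_one_iff_subsingleton.1
    (Nat.le_of_mul_le_mul_left (by simpa using hcard) hpos)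
  have hne : Nonempty ι := by
    by_contra hemp
    rw [not_nonempty_iff] at hemp
    have h01 := B.repr.injective (Subsingleton.elim (B.repr ⟨1, one_mem (integralClosure ℤ L)⟩)
      (B.repr 0))
    exact one_ne_zero (congrArg Subtype.val h01)
  obtain ⟨i⟩ := hne
  refine ⟨B i, (B i).2, fun y hy => ⟨B.repr ⟨y, hy⟩ i, (B.repr ⟨y, hy⟩ i).2, ?_⟩⟩
  have h := B.sum_repr ⟨y, hy⟩
  rw [Fintype.sum_subsingleton _ i] at h
  exact (congrArg Subtype.val h).symm

end Generator

/-! ### Integers in quadratic subfields. -/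

section Integrality

/-- The square of the denominator of `r` is coprime to its numerator squared, so it divides `m`. -/
theorem exists_int_of_squarefree_mul_sq {m : ℤ} (hm : Squarefree m) {r : ℚ} {N : ℤ}
    (h : (m : ℚ) * r ^ 2 = N) : ∃ n : ℤ, r = n := by
  have hden : (r.den : ℤ) ∣ 1 := by
    have h₁ : m * r.num ^ 2 = (r.den : ℤ) ^ 2 * N := by
      have h₂ : (r.den : ℚ) ≠ 0 := by exact_mod_cast r.den_ne_zero
      rw [← Rat.num_div_den r] at h
      field_simp at h
      exact_mod_cast h
    have hc : IsCoprime ((r.den : ℤ) ^ 2) (r.num ^ 2) := by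
      refine IsCoprime.pow (Int.isCoprime_iff_nat_coprime.2 ?_)
      simpa using r.reduced.symm
    have h₂ : (r.den : ℤ) ^ 2 ∣ m := hc.dvd_of_dvd_mul_right ⟨N, h₁⟩
    exact (hm _ (by rwa [← sq])).dvd
  have h₁ : r.den = 1 := by
    exact_mod_cast Int.eq_one_of_dvd_one (by positivity) hden
  exact ⟨r.num, (Rat.den_eq_one_iff r).1 h₁ |>.symm⟩

theorem isIntegral_of_eq {L : Type*} [Field L] {x y : L} (hx : IsIntegral ℤ x) (h : y = x) :
    IsIntegral ℤ y :=
  h ▸ hx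

variable {L : Type*} [Field L] [NumberField L]

theorem exists_int_of_isIntegral_ratCast {r : ℚ} (h : IsIntegral ℤ (r : L)) : ∃ n : ℤ, r = n := by
  have h₁ : IsIntegral ℤ r := (isIntegral_algebraMap_iff (algebraMap ℚ L).injective).1
    (by simpa using h)
  obtain ⟨n, hn⟩ := IsIntegrallyClosed.isIntegral_iff.1 h₁
  exact ⟨n, by simpa using hn.symm⟩

theorem isIntegral_apply (g : Gal ℚ L) {y : L} (hy : IsIntegral ℤ y) : IsIntegral ℤ (g y) :=
  map_isIntegral_int (g : L →+* L) hy

/-- The trace `2p` and the norm `p² - mq²` are rational integers; then `m(2q)²` is one too, and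
square-freeness of `m` gives `2q ∈ ℤ`. -/
theorem exists_int_of_isIntegral_add_mul {m : ℤ} (hm : Squarefree m) {θ : L}
    (hθ : θ ^ 2 = (m : L)) {g : Gal ℚ L} (hg : g θ = -θ) {p q : ℚ}
    (h : IsIntegral ℤ (p + q * θ : L)) :
    ∃ i j : ℤ, 2 * p = i ∧ 2 * q = j ∧ 4 ∣ i ^ 2 - m * j ^ 2 := by
  have h' := isIntegral_apply g h
  obtain ⟨i, hi⟩ := exists_int_of_isIntegral_ratCast (L := L) (r := 2 * p)
    (isIntegral_of_eq (h.add h') <| by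
    simp [hg]
    ring)
  obtain ⟨N, hN⟩ := exists_int_of_isIntegral_ratCast (L := L) (r := p ^ 2 - m * q ^ 2)
    (isIntegral_of_eq (h.mul h') <| by
    simp [hg, ← hθ]
    ring)
  obtain ⟨j, hj⟩ := exists_int_of_squarefree_mul_sq hm (r := 2 * q) (N := i ^ 2 - 4 * N) (by
    push_cast
    rw [← hi, ← hN]
    ring)
  refine ⟨i, j, hi, hj, N, ?_⟩
  have : (i ^ 2 - m * j ^ 2 : ℚ) = 4 * N := by
    rw [← hi, ← hj, ← hN]
    ring
  exact_mod_cast this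

theorem isIntegral_half_one_add {m : ℤ} (hm : m ≡ 1 [ZMOD 4]) {θ : L} (hθ : θ ^ 2 = (m : L)) :
    IsIntegral ℤ ((1 + θ) / 2) := by
  obtain ⟨n, hn⟩ := hm.symm.dvd
  refine ⟨Polynomial.X ^ 2 - Polynomial.X - Polynomial.C n, by monicity!, ?_⟩
  have hm' : (m : L) = 4 * n + 1 := by exact_mod_cast (by omega : m = 4 * n + 1)
  simp only [Polynomial.eval₂_sub, Polynomial.eval₂_pow, Polynomial.eval₂_X, Polynomial.eval₂_C,
    algebraMap_int_eq, Int.coe_castRingHom]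
  linear_combination (hθ + hm') / 4

end Integrality

/-! ### The lattice of differences `y - τ y`. -/

section Lattice

variable {L : Type*} [Field L] [NumberField L]

/-- Square roots `α`, `β`, `γ` of the pairwise products `de`, `df`, `ef` that generate the
biquadratic field `L`, with generators `ρ`, `τ` of its Galois group. -/
structure IsBiquadratic (α β γ : L) (ρ τ : Gal ℚ L) (d e f : ℤ) : Prop where
  sq_α : α ^ 2 = ((d * e : ℤ) : L)
  sq_β : β ^ 2 = ((d * f : ℤ) : L)
  mul_γ : d * γ = α * β
  ρ_α : ρ α = -α
  ρ_β : ρ β = β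
  τ_α : τ α = α
  τ_β : τ β = -β
  coordinates : ∀ y : L, ∃ x₀ x₁ x₂ x₃ : ℚ, y = x₀ + x₁ * α + x₂ * β + x₃ * γ
  unique : ∀ {p q p' q' : ℚ}, (p * β + q * γ : L) = p' * β + q' * γ → p = p' ∧ q = q'
  squarefree_de : Squarefree (d * e)
  squarefree_df : Squarefree (d * f)
  squarefree_ef : Squarefree (e * f)
  d_pos : 0 < d
  e_pos : 0 < e
  modEq : d * e ≡ 1 [ZMOD 4]

namespace IsBiquadratic

variable {α β γ : L} {ρ τ : Gal ℚ L} {d e f : ℤ}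

theorem d_ne_zero (h : IsBiquadratic α β γ ρ τ d e f) : (d : L) ≠ 0 := by
  exact_mod_cast h.d_pos.ne'

theorem sq_γ (h : IsBiquadratic α β γ ρ τ d e f) : γ ^ 2 = ((e * f : ℤ) : L) := by
  have h₁ := h.sq_α
  have h₂ := h.sq_β
  push_cast at *
  apply mul_left_cancel₀ (pow_ne_zero 2 h.d_ne_zero)
  rw [← mul_pow, h.mul_γ, mul_pow, h₁, h₂]
  ring

theorem α_mul_γ (h : IsBiquadratic α β γ ρ τ d e f) : α * γ = e * β := by
  have h₁ := h.sq_α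
  push_cast at *
  apply mul_left_cancel₀ h.d_ne_zero
  linear_combination α * h.mul_γ + β * h₁

theorem β_mul_γ (h : IsBiquadratic α β γ ρ τ d e f) : β * γ = f * α := by
  have h₁ := h.sq_β
  push_cast at *
  apply mul_left_cancel₀ h.d_ne_zero
  linear_combination β * h.mul_γ + α * h₁

theorem ρ_γ (h : IsBiquadratic α β γ ρ τ d e f) : ρ γ = -γ := by
  apply mul_left_cancel₀ h.d_ne_zero
  have := congrArg ρ h.mul_γ
  simp only [map_mul, map_intCast, h.ρ_α, h.ρ_β] at this
  linear_combination this + h.mul_γ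

theorem τ_γ (h : IsBiquadratic α β γ ρ τ d e f) : τ γ = -γ := by
  apply mul_left_cancel₀ h.d_ne_zero
  have := congrArg τ h.mul_γ
  simp only [map_mul, map_intCast, h.τ_α, h.τ_β] at this
  linear_combination this + h.mul_γ

/-- From `de ≡ 1` modulo `4` follows `d ≡ e`, so `β²` and `γ²` lie in the same class modulo `4`. -/
theorem d_mul_f_modEq (h : IsBiquadratic α β γ ρ τ d e f) : d * f ≡ e * f [ZMOD 4] := by
  have key : ∀ d e f : ZMod 4, d * e = 1 → d * f = e * f := by decide
  have h₁ := (ZMod.intCast_eq_intCast_iff _ _ 4).2 h.modEq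
  refine (ZMod.intCast_eq_intCast_iff _ _ 4).1 ?_
  push_cast at *
  exact key _ _ _ h₁

theorem d_add_e_emod (h : IsBiquadratic α β γ ρ τ d e f) : (d + e) % 4 = 2 := by
  have key : ∀ d e : ZMod 4, d * e = 1 → d + e = 2 := by decide
  have h₁ := (ZMod.intCast_eq_intCast_iff _ _ 4).2 h.modEq
  refine (ZMod.intCast_eq_intCast_iff _ 2 4).1 ?_
  push_cast at *
  exact key _ _ h₁

theorem e_odd (h : IsBiquadratic α β γ ρ τ d e f) : ∃ n, e = 2 * n + 1 := by
  have key : ∀ d e : ZMod 4, d * e = 1 → e = 1 ∨ e = 3 := by decide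
  have h₁ := (ZMod.intCast_eq_intCast_iff _ _ 4).2 h.modEq
  push_cast at h₁
  rcases key _ _ h₁ with h₂ | h₂
  · have h₃ : e ≡ 1 [ZMOD 4] := (ZMod.intCast_eq_intCast_iff _ 1 4).1 (by exact_mod_cast h₂)
    exact ⟨e / 2, by have : e % 4 = 1 := h₃; omega⟩
  · have h₃ : e ≡ 3 [ZMOD 4] := (ZMod.intCast_eq_intCast_iff _ 3 4).1 (by exact_mod_cast h₂)
    exact ⟨e / 2, by have : e % 4 = 3 := h₃; omega⟩

/-- The traces of an integer to `ℚ(β)` and `ℚ(γ)`. -/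
theorem exists_int_coordinates (h : IsBiquadratic α β γ ρ τ d e f) {x₀ x₁ x₂ x₃ : ℚ}
    (hy : IsIntegral ℤ (x₀ + x₁ * α + x₂ * β + x₃ * γ : L)) :
    ∃ i u w : ℤ, 4 * x₀ = i ∧ 4 * x₂ = u ∧ 4 * x₃ = w ∧ 4 ∣ i ^ 2 - d * f * u ^ 2 ∧
      4 ∣ i ^ 2 - e * f * w ^ 2 := by
  obtain ⟨i, u, hi, hu, hiu⟩ := exists_int_of_isIntegral_add_mul h.squarefree_df h.sq_β h.τ_β
    (p := 2 * x₀) (q := 2 * x₂)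
      (isIntegral_of_eq (hy.add (isIntegral_apply ρ hy)) <| by
      simp [h.ρ_α, h.ρ_β, h.ρ_γ]
      ring)
  obtain ⟨i', w, hi', hw, hiw⟩ := exists_int_of_isIntegral_add_mul h.squarefree_ef h.sq_γ h.τ_γ
    (p := 2 * x₀) (q := 2 * x₃)
      (isIntegral_of_eq (hy.add (isIntegral_apply ρ (isIntegral_apply τ hy))) <| by
      simp [h.ρ_α, h.ρ_β, h.ρ_γ, h.τ_α, h.τ_β, h.τ_γ]
      ring)
  obtain rfl : i = i' := by exact_mod_cast hi.symm.trans hi'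
  exact ⟨i, u, w, by linarith, by linarith, by linarith, hiu, hiw⟩

theorem sub_τ (h : IsBiquadratic α β γ ρ τ d e f) (x₀ x₁ x₂ x₃ : ℚ) :
    (x₀ + x₁ * α + x₂ * β + x₃ * γ : L) - τ (x₀ + x₁ * α + x₂ * β + x₃ * γ) =
      2 * (x₂ * β + x₃ * γ) := by
  simp only [map_add, map_mul, map_ratCast, h.τ_α, h.τ_β, h.τ_γ]
  ring

/-- The lattice `{y - τ y | y ∈ O_L}` is `ℤ sβ + ℤ s(β + γ)/2`. -/
structure IsLattice (β γ : L) (τ : Gal ℚ L) (s : ℚ) : Prop where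
  ne_zero : s ≠ 0
  sub_eq : ∀ y : L, IsIntegral ℤ y → ∃ u w : ℤ, 2 ∣ u - w ∧
    y - τ y = (s * u / 2 : ℚ) * β + (s * w / 2 : ℚ) * γ
  exists_fst : ∃ y : L, IsIntegral ℤ y ∧ y - τ y = (s : ℚ) * β + (0 : ℚ) * γ
  exists_snd : ∃ y : L, IsIntegral ℤ y ∧ y - τ y = (s / 2 : ℚ) * β + (s / 2 : ℚ) * γ

theorem isLattice_of_modEq_one (h : IsBiquadratic α β γ ρ τ d e f)
    (hb : d * f ≡ 1 [ZMOD 4]) : IsLattice β γ τ 1 := by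
  have hk : e * f ≡ 1 [ZMOD 4] := h.d_mul_f_modEq.symm.trans hb
  have hβ : IsIntegral ℤ ((1 + β) / 2) := isIntegral_half_one_add hb h.sq_β
  refine ⟨one_ne_zero, fun y hy => ?_, ⟨(1 + β) / 2, hβ, ?_⟩, ?_⟩
  · obtain ⟨x₀, x₁, x₂, x₃, rfl⟩ := h.coordinates y
    obtain ⟨i, u, w, -, hu, hw, hiu, hiw⟩ := h.exists_int_coordinates hy
    refine ⟨u, w, ?_, ?_⟩
    · have key : ∀ i u w : ZMod 4, i ^ 2 - u ^ 2 = 0 → i ^ 2 - w ^ 2 = 0 → 2 * (u - w) = 0 := by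
        decide
      have h₁ := (ZMod.intCast_zmod_eq_zero_iff_dvd _ 4).2 hiu
      have h₂ := (ZMod.intCast_zmod_eq_zero_iff_dvd _ 4).2 hiw
      have hb' := (ZMod.intCast_eq_intCast_iff _ _ 4).2 hb
      have hk' := (ZMod.intCast_eq_intCast_iff _ _ 4).2 hk
      push_cast at h₁ h₂ hb' hk'
      rw [hb', one_mul] at h₁
      rw [hk', one_mul] at h₂
      have h₃ : ((2 * (u - w) : ℤ) : ZMod 4) = 0 := by
        push_cast
        exact key _ _ _ h₁ h₂
      have := (ZMod.intCast_zmod_eq_zero_iff_dvd _ 4).1 h₃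
      omega
    · rw [h.sub_τ, ← hu, ← hw]
      push_cast
      ring
  · simp [map_ofNat, h.τ_β]
    ring
  · obtain ⟨n, hn⟩ := h.e_odd
    -- As `αγ = eβ`, the product contributes `(eβ + γ)/2` to the difference; subtracting `n(1 +
    -- β)/2` with `e = 2n + 1` reduces the coefficient `e` to `1`.
    refine ⟨(1 + α) / 2 * ((1 + γ) / 2) - n * ((1 + β) / 2),
      ((isIntegral_half_one_add h.modEq h.sq_α).mul (isIntegral_half_one_add hk h.sq_γ)).sub
        ((isIntegral_algebraMap (x := n)).mul hβ), ?_⟩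
    have hn' : (e : L) = 2 * n + 1 := by exact_mod_cast hn
    simp [map_ofNat, h.τ_α, h.τ_β, h.τ_γ]
    linear_combination h.α_mul_γ / 2 + β / 2 * hn'

theorem isLattice_of_modEq_two_or_three (h : IsBiquadratic α β γ ρ τ d e f)
    (hb : d * f ≡ 2 [ZMOD 4] ∨ d * f ≡ 3 [ZMOD 4]) : IsLattice β γ τ 2 := by
  have isIntegral_of_sq {θ : L} {m : ℤ} (hθ : θ ^ 2 = (m : L)) : IsIntegral ℤ θ :=
    IsIntegral.of_pow two_pos (by rw [hθ]; exact isIntegral_algebraMap (x := m))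
  have hk : ((e * f : ℤ) : ZMod 4) = ((d * f : ℤ) : ZMod 4) :=
    (ZMod.intCast_eq_intCast_iff _ _ 4).2 h.d_mul_f_modEq.symm
  have ha : ((d * e : ℤ) : ZMod 4) = 1 := by
    exact_mod_cast (ZMod.intCast_eq_intCast_iff _ _ 4).2 h.modEq
  have hb' : ((d * f : ℤ) : ZMod 4) = 2 ∨ ((d * f : ℤ) : ZMod 4) = 3 := by
    rcases hb with hb | hb
    · exact .inl (by exact_mod_cast (ZMod.intCast_eq_intCast_iff _ _ 4).2 hb)
    · exact .inr (by exact_mod_cast (ZMod.intCast_eq_intCast_iff _ _ 4).2 hb)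
  have two_dvd {n : ℤ} (hn : 2 * (n : ZMod 4) = 0) : 2 ∣ n := by
    have := (ZMod.intCast_zmod_eq_zero_iff_dvd (2 * n) 4).1 (by exact_mod_cast hn)
    omega
  refine ⟨two_ne_zero, fun y hy => ?_, ⟨β, isIntegral_of_sq h.sq_β, ?_⟩,
    ⟨(β + γ) / 2, ?_, ?_⟩⟩
  · obtain ⟨x₀, x₁, x₂, x₃, rfl⟩ := h.coordinates y
    obtain ⟨i, u, w, hi, hu, hw, hiu, hiw⟩ := h.exists_int_coordinates hy
    -- The traces to `ℚ(β)`, `ℚ(γ)` and then `ℚ(α)` reduce the denominators from `4` to `2`.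
    have key : ∀ i u b : ZMod 4, (b = 2 ∨ b = 3) → i ^ 2 - b * u ^ 2 = 0 →
        2 * i = 0 ∧ 2 * u = 0 := by decide
    have h₁ := (ZMod.intCast_zmod_eq_zero_iff_dvd _ 4).2 hiu
    have h₂ := (ZMod.intCast_zmod_eq_zero_iff_dvd _ 4).2 hiw
    rw [Int.cast_sub, Int.cast_mul _ (u ^ 2), Int.cast_pow, Int.cast_pow] at h₁
    rw [Int.cast_sub, Int.cast_mul _ (w ^ 2), Int.cast_pow, Int.cast_pow, hk] at h₂
    obtain ⟨i, rfl⟩ := two_dvd (key _ _ _ hb' h₁).1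
    obtain ⟨u, rfl⟩ := two_dvd (key _ _ _ hb' h₁).2
    obtain ⟨w, rfl⟩ := two_dvd (key _ _ _ hb' h₂).2
    obtain ⟨i', j, hi', hj, hij⟩ := exists_int_of_isIntegral_add_mul h.squarefree_de h.sq_α h.ρ_α
      (p := 2 * x₀) (q := 2 * x₁)
        (isIntegral_of_eq (hy.add (isIntegral_apply τ hy)) <| by
        simp [h.τ_α, h.τ_β, h.τ_γ]
        ring)
    obtain rfl : i' = 2 * i := by
      have : (i' : ℚ) = ((2 * i : ℤ) : ℚ) := by rw [← hi', ← hi]; ring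
      exact_mod_cast this
    have key₂ : ∀ i j : ZMod 4, (2 * i) ^ 2 - 1 * j ^ 2 = 0 → 2 * j = 0 := by decide
    have h₃ := (ZMod.intCast_zmod_eq_zero_iff_dvd _ 4).2 hij
    rw [Int.cast_sub, Int.cast_mul _ (j ^ 2), Int.cast_pow, Int.cast_pow, ha] at h₃
    obtain ⟨j, rfl⟩ := two_dvd (key₂ i j (by exact_mod_cast h₃))
    push_cast at hi hu hw hj
    -- The traces do not compare the parities of `u` and `w`. The relative norm `y · τ y = ((i +
    -- jα)² - (uβ + wγ)²)/4` to `ℚ(α)` does.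
    obtain ⟨I, J, hI, hJ, hIJ⟩ := exists_int_of_isIntegral_add_mul h.squarefree_de h.sq_α h.ρ_α
      (p := (i ^ 2 + d * e * j ^ 2 - d * f * u ^ 2 - e * f * w ^ 2) / 4)
      (q := (i * j - u * w * f) / 2)
        (isIntegral_of_eq (hy.mul (isIntegral_apply τ hy)) <| by
        obtain rfl : x₀ = i / 2 := by linarith
        obtain rfl : x₁ = j / 2 := by linarith
        obtain rfl : x₂ = u / 2 := by linarith
        obtain rfl : x₃ = w / 2 := by linarith
        have hα := h.sq_α
        have hβ := h.sq_β
        have hγ := h.sq_γ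
        push_cast at hα hβ hγ
        simp [map_ofNat, h.τ_α, h.τ_β, h.τ_γ]
        linear_combination (-j ^ 2 / 4 : L) * hα + (u ^ 2 / 4 : L) * hβ + (w ^ 2 / 4 : L) * hγ
          + (u * w / 2 : L) * h.β_mul_γ)
    have hI' : i ^ 2 + d * e * j ^ 2 - d * f * u ^ 2 - e * f * w ^ 2 = 2 * I := by
      have : (i ^ 2 + d * e * j ^ 2 - d * f * u ^ 2 - e * f * w ^ 2 : ℚ) = 2 * I := by linarith
      exact_mod_cast this
    have hJ' : i * j - u * w * f = J := by
      have : (i * j - u * w * f : ℚ) = J := by linarith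
      exact_mod_cast this
    refine ⟨u, w, two_dvd ?_, ?_⟩
    · have hb₂ := congrArg (Int.cast (R := ZMod 4)) hI'
      have h₄ := (ZMod.intCast_zmod_eq_zero_iff_dvd _ 4).2 hIJ
      rw [Int.cast_sub, Int.cast_sub, Int.cast_add, Int.cast_mul _ (j ^ 2), Int.cast_mul _ (u ^ 2),
        Int.cast_mul _ (w ^ 2), ha, hk] at hb₂
      rw [Int.cast_sub, Int.cast_mul _ (J ^ 2), ha] at h₄
      have hJ₂ := congrArg (Int.cast (R := ZMod 4)) hJ'
      generalize ((d * f : ℤ) : ZMod 4) = B at hb₂ hb'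
      push_cast at hb₂ h₄ hJ₂ ⊢
      have key₃ : ∀ I J : ZMod 4, I ^ 2 - 1 * J ^ 2 = 0 → 2 * I = 2 * J := by decide
      -- If `u` and `w` had different parities, then `D² ≡ B` modulo `4`, but neither `2` nor `3` is
      -- a square there.
      have key₄ : ∀ D u w F B : ZMod 4, (B = 2 ∨ B = 3) →
          D ^ 2 + 2 * (u * w * F) = B * (u ^ 2 + w ^ 2) → 2 * (u - w) = 0 := by decide
      refine key₄ (i - j) u w f B hb' ?_
      linear_combination hb₂ + key₃ _ _ h₄ - 2 * hJ₂
    · rw [h.sub_τ]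
      obtain rfl : x₂ = u / 2 := by linarith
      obtain rfl : x₃ = w / 2 := by linarith
      push_cast
      ring
  · simp [h.τ_β]
    ring
  · obtain ⟨n, hn⟩ : ∃ n, d + e = 2 * (2 * n + 1) :=
      ⟨(d + e) / 4, by have := h.d_add_e_emod; omega⟩
    -- The square of `(β + γ)/2` is `f(d + e + 2α)/4 = f(n + (1 + α)/2)`.
    refine IsIntegral.of_pow two_pos ?_
    have hα := (isIntegral_half_one_add h.modEq h.sq_α)
    refine isIntegral_of_eq ((isIntegral_algebraMap (R := ℤ) (A := L) (x := f)).mul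
      ((isIntegral_algebraMap (x := n)).add hα)) ?_
    have hβ := h.sq_β
    have hγ := h.sq_γ
    have hn' : (d + e : L) = 2 * (2 * n + 1) := by exact_mod_cast hn
    push_cast at hβ hγ
    simp
    linear_combination hβ / 4 + hγ / 4 + h.β_mul_γ / 2 + f / 4 * hn'
  · simp [map_ofNat, h.τ_β, h.τ_γ]
    ring

end IsBiquadratic

end Lattice

/-! ### The order `ℤ[√(-a)]` and the definite form `du² + ew²`. -/

section Conclusion

/-- The equations say that two elements of `ℤ[√(-de)]` send `(u₁, w₁)` to `(2, 0)` and `(1, 1)`.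
Taking determinants, `du₁² + ew₁²` divides `2`. If both entries are non-zero the form is at least `d
+ e > 2`; if one vanishes, the other is even and the form is zero or at least `4`. -/
theorem not_represents {d e u₁ w₁ p₁ q₁ p₂ q₂ : ℤ} (hd : 0 < d) (he : 0 < e) (hde : 1 < d * e)
    (h4 : d * e ≡ 1 [ZMOD 4]) (huw : 2 ∣ u₁ - w₁)
    (h₁ : p₁ * u₁ - q₁ * e * w₁ = 2) (h₂ : p₁ * w₁ + q₁ * d * u₁ = 0)
    (h₃ : p₂ * u₁ - q₂ * e * w₁ = 1) (h₄ : p₂ * w₁ + q₂ * d * u₁ = 1) : False := by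
  have hdet : (d * u₁ ^ 2 + e * w₁ ^ 2) * (p₁ * q₂ - p₂ * q₁) = 2 := by
    linear_combination (p₂ * w₁ + q₂ * d * u₁) * h₁ + 2 * h₄ -
      (p₂ * u₁ - q₂ * e * w₁) * h₂
  have hle : d * u₁ ^ 2 + e * w₁ ^ 2 ≤ 2 := Int.le_of_dvd two_pos ⟨_, hdet.symm⟩
  have hne : d ≠ 2 ∧ e ≠ 2 := by
    constructor <;> rintro rfl <;> rw [Int.ModEq] at h4 <;> omega
  have hde' : 2 < d + e := by nlinarith
  have key {u : ℤ} (hu : u ≠ 0) : 1 ≤ u ^ 2 := by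
    have := sq_pos_of_ne_zero hu
    omega
  by_cases hu : u₁ = 0
  · subst hu
    obtain ⟨n, hn⟩ : 2 ∣ w₁ := by omega
    subst hn
    have hn : n ≠ 0 := by
      rintro rfl
      simp at h₁
    nlinarith [key hn]
  · by_cases hw : w₁ = 0
    · subst hw
      obtain ⟨n, hn⟩ : 2 ∣ u₁ := by omega
      subst hn
      have hn : n ≠ 0 := by
        rintro rfl
        simp at h₁
      nlinarith [key hn]
    · nlinarith [key hu, key hw]

variable {L : Type*} [Field L] [NumberField L] {α β γ : L} {ρ τ : Gal ℚ L} {d e f : ℤ}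

namespace IsBiquadratic

/-- Operators that act on `{y - τ y}` through `ℚ(√(-de))` and preserve `O_L` act through
`ℤ[√(-de)]`. -/
theorem exists_int_of_preserves (h : IsBiquadratic α β γ ρ τ d e f) {s : ℚ}
    (hs : IsLattice β γ τ s) {p q : ℚ} {T : L → L}
    (hT : ∀ y, IsIntegral ℤ y → IsIntegral ℤ (T y))
    (hact : ∀ (y : L) (P Q : ℚ), y - τ y = P * β + Q * γ →
      T y - τ (T y) = (p * P - q * e * Q : ℚ) * β + (p * Q + q * d * P : ℚ) * γ) :
    ∃ i j : ℤ, p = i ∧ q = j := by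
  have hs0 := hs.ne_zero
  obtain ⟨y₁, hy₁, hy₁'⟩ := hs.exists_fst
  obtain ⟨y₂, hy₂, hy₂'⟩ := hs.exists_snd
  obtain ⟨u, w, -, h₁⟩ := hs.sub_eq _ (hT y₁ hy₁)
  obtain ⟨u', w', huw, h₂⟩ := hs.sub_eq _ (hT y₂ hy₂)
  obtain ⟨h₃, h₄⟩ := h.unique ((hact _ _ _ hy₁').symm.trans h₁)
  obtain ⟨h₅, h₆⟩ := h.unique ((hact _ _ _ hy₂').symm.trans h₂)
  have e₁ : 2 * p = u := mul_left_cancel₀ hs0 (by linear_combination 2 * h₃)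
  have e₂ : 2 * q * d = w := mul_left_cancel₀ hs0 (by linear_combination 2 * h₄)
  have e₃ : p - q * e = u' := mul_left_cancel₀ hs0 (by linear_combination 2 * h₅)
  have e₄ : p + q * d = w' := mul_left_cancel₀ hs0 (by linear_combination 2 * h₆)
  -- Both `2qd` and `2qe` are integers, so coprimality of `d` and `e` gives `2q ∈ ℤ`.
  have hde : IsCoprime d e := (squarefree_mul_iff.1 h.squarefree_de).1.isCoprime
  obtain ⟨r, t, hrt⟩ := hde
  have hrt' : (r * d + t * e : ℚ) = 1 := by exact_mod_cast hrt
  have e₅ : 2 * q = (r * w + t * (u - 2 * u') : ℤ) := by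
    push_cast
    linear_combination (-2 * q) * hrt' + r * e₂ + t * e₁ - 2 * t * e₃
  obtain ⟨n, hn⟩ : ∃ n : ℤ, 2 * q = n := ⟨_, e₅⟩
  have e₆ : n * (d + e) = 2 * (w' - u') := by
    have : (n * (d + e) : ℚ) = 2 * (w' - u') := by
      rw [← hn]
      linear_combination 2 * e₄ - 2 * e₃
    exact_mod_cast this
  obtain ⟨k, hk⟩ : ∃ k, d + e = 2 * (2 * k + 1) :=
    ⟨(d + e) / 4, by have := h.d_add_e_emod; omega⟩
  obtain ⟨c, hc⟩ := huw
  -- Here `n(d + e)/2 = w' - u'` is even while `(d + e)/2 = 2k + 1` is odd, so `n = 2q` is even.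
  obtain ⟨j, hj⟩ : ∃ j, n = 2 * j := ⟨-c - n * k, by rw [hk] at e₆; linarith⟩
  have hq : q = j := by
    have : (n : ℚ) = 2 * j := by exact_mod_cast hj
    linarith
  exact ⟨u' + j * e, j, by push_cast; rw [← hq]; linarith, hq⟩

/-- No integer `x` generates `O_L` under operators that act on `{y - τ y}` through
`ℚ(√(-de))`. -/
theorem not_generated (h : IsBiquadratic α β γ ρ τ d e f) (hde : 1 < d * e) {s : ℚ}
    (hs : IsLattice β γ τ s) {x : L} (hx : IsIntegral ℤ x)
    (hgen : ∀ y, IsIntegral ℤ y → ∃ (T : L → L) (p q : ℚ), T x = y ∧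
      (∀ y, IsIntegral ℤ y → IsIntegral ℤ (T y)) ∧
      ∀ (y : L) (P Q : ℚ), y - τ y = P * β + Q * γ →
        T y - τ (T y) = (p * P - q * e * Q : ℚ) * β + (p * Q + q * d * P : ℚ) * γ) : False := by
  have hs0 := hs.ne_zero
  obtain ⟨u, w, huw, hxuw⟩ := hs.sub_eq x hx
  obtain ⟨y₁, hy₁, hy₁'⟩ := hs.exists_fst
  obtain ⟨y₂, hy₂, hy₂'⟩ := hs.exists_snd
  obtain ⟨T₁, p₁, q₁, rfl, hT₁, hact₁⟩ := hgen y₁ hy₁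
  obtain ⟨T₂, p₂, q₂, rfl, hT₂, hact₂⟩ := hgen y₂ hy₂
  obtain ⟨p₁, q₁, rfl, rfl⟩ := h.exists_int_of_preserves hs hT₁ hact₁
  obtain ⟨p₂, q₂, rfl, rfl⟩ := h.exists_int_of_preserves hs hT₂ hact₂
  obtain ⟨h₁, h₂⟩ := h.unique ((hact₁ _ _ _ hxuw).symm.trans hy₁')
  obtain ⟨h₃, h₄⟩ := h.unique ((hact₂ _ _ _ hxuw).symm.trans hy₂')
  have e₁ : (p₁ * u - q₁ * e * w : ℚ) = 2 :=
    mul_left_cancel₀ hs0 (by linear_combination 2 * h₁)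
  have e₂ : (p₁ * w + q₁ * d * u : ℚ) = 0 :=
    mul_left_cancel₀ hs0 (by linear_combination 2 * h₂)
  have e₃ : (p₂ * u - q₂ * e * w : ℚ) = 1 :=
    mul_left_cancel₀ hs0 (by linear_combination 2 * h₃)
  have e₄ : (p₂ * w + q₂ * d * u : ℚ) = 1 :=
    mul_left_cancel₀ hs0 (by linear_combination 2 * h₄)
  exact not_represents h.d_pos h.e_pos hde h.modEq huw (by exact_mod_cast e₁)
    (by exact_mod_cast e₂) (by exact_mod_cast e₃) (by exact_mod_cast e₄)

/-- The action on `{y - τ y}` of the Hopf-Galois structure given by `α`. -/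
theorem sub_τ_of_smul_eq (h : IsBiquadratic α β γ ρ τ d e f) {c₀ c₁ c₂ c₃ : ℚ} {T : L → L}
    (hT : ∀ x : L, T x = c₀ * x + c₁ * τ x + c₂ * (ρ x + ρ (τ x)) + c₃ * α * (ρ x - ρ (τ x)))
    (y : L) (P Q : ℚ) (hy : y - τ y = P * β + Q * γ) :
    T y - τ (T y) = ((c₀ - c₁) * P - 2 * c₃ * e * Q : ℚ) * β +
      ((c₀ - c₁) * Q + 2 * c₃ * d * P : ℚ) * γ := by
  obtain ⟨x₀, x₁, x₂, x₃, rfl⟩ := h.coordinates y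
  rw [h.sub_τ] at hy
  obtain ⟨rfl, rfl⟩ := h.unique (p := 2 * x₂) (q := 2 * x₃) (p' := P) (q' := Q) (by
    push_cast
    linear_combination hy)
  rw [hT]
  simp only [map_add, map_sub, map_mul, map_neg, map_ratCast, h.τ_α, h.τ_β, h.τ_γ, h.ρ_α, h.ρ_β,
    h.ρ_γ]
  push_cast
  linear_combination (-4 * c₃ * x₂ : L) * h.mul_γ - (4 * c₃ * x₃ : L) * h.α_mul_γ

end IsBiquadratic

theorem exists_isBiquadratic {a b : ℤ} (ha : Squarefree a) (hb : Squarefree b)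
    (ha4 : a ≡ 1 [ZMOD 4]) (ha1 : 1 < a) (hdeg : Module.finrank ℚ L = 4)
    (hα : α ^ 2 = (a : L)) (hβ : β ^ 2 = (b : L)) (hL : ℚ⟮α, β⟯ = ⊤)
    (hρα : ρ α = -α) (hρβ : ρ β = β) (hτα : τ α = α) (hτβ : τ β = -β) :
    ∃ (γ : L) (d e f : ℤ), a = d * e ∧ b = d * f ∧ IsBiquadratic α β γ ρ τ d e f := by
  obtain ⟨d, hd, e, f, hef, rfl, rfl⟩ : ∃ d : ℤ, 0 < d ∧ ∃ e f : ℤ, IsCoprime e f ∧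
      a = d * e ∧ b = d * f := by
    have hpos : 0 < (Int.gcd a b : ℤ) := by
      exact_mod_cast Int.gcd_pos_of_ne_zero_left b (by omega)
    refine ⟨Int.gcd a b, hpos, a / Int.gcd a b, b / Int.gcd a b, ?_,
      (Int.mul_ediv_cancel' (Int.gcd_dvd_left _ _)).symm,
      (Int.mul_ediv_cancel' (Int.gcd_dvd_right _ _)).symm⟩
    rw [Int.isCoprime_iff_gcd_eq_one]
    exact Int.gcd_ediv_gcd_ediv_gcd (by exact_mod_cast hpos)
  have hd0 : (d : L) ≠ 0 := by exact_mod_cast hd.ne'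
  have hdq : (d : ℚ) ≠ 0 := by exact_mod_cast hd.ne'
  refine ⟨α * β / d, d, e, f, rfl, rfl, hα, hβ, mul_div_cancel₀ _ hd0, hρα, hρβ, hτα, hτβ,
    fun y => ?_, fun {p q p' q'} h => ?_, ha, hb, ?_, hd, ?_, ha4⟩
  · obtain ⟨x₀, x₁, x₂, x₃, rfl⟩ := exists_coordinates hα hβ hL y
    refine ⟨x₀, x₁, x₂, x₃ * d, ?_⟩
    push_cast
    field_simp
  · obtain ⟨-, -, h₁, h₂⟩ := coordinates_unique hdeg hα hβ hL (x₀ := 0) (x₁ := 0) (x₂ := p)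
      (x₃ := q / d) (y₀ := 0) (y₁ := 0) (y₂ := p') (y₃ := q' / d) (by
        push_cast
        linear_combination h)
    exact ⟨h₁, (div_left_inj' hdq).1 h₂⟩
  · exact squarefree_mul_iff.2 ⟨hef.isRelPrime, ha.squarefree_of_dvd (dvd_mul_left _ _),
      hb.squarefree_of_dvd (dvd_mul_left _ _)⟩
  · exact pos_of_mul_pos_right (by omega) hd.le

end Conclusion

end HopfGaloisTheory

/-! ### The main theorem. -/

open HopfGaloisTheory

theorem mainTheorem8 {L : Type*} [Field L] [NumberField L] (a b : ℤ)
    (ha : Squarefree a) (hb : Squarefree b) (ha4 : a ≡ 1 [ZMOD 4])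
    (hdeg : Module.finrank ℚ L = 4) (α β : L)
    (hα : α ^ 2 = (a : L)) (hβ : β ^ 2 = (b : L)) (hL : ℚ⟮α, β⟯ = ⊤)
    {H : Type*} [Ring H] [HopfAlgebra ℚ H] [Module H L] [IsScalarTower ℚ H L]
    [HopfGaloisTheory.IsHopfGalois ℚ L H] (hH : HopfGaloisTheory.IsGivenBy ℚ H α)
    (ha1 : 1 < a) :
    ¬ Module.Free (HopfGaloisTheory.associatedOrder L H) (HopfGaloisTheory.integersModule L H) := by
  intro hfree
  obtain ⟨ρ, τ, hρα, hρβ, hτα, hτβ, hact⟩ := hH.exists_smul_eq hdeg hα hβ hL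
  obtain ⟨γ, d, e, f, rfl, rfl, h⟩ :=
    exists_isBiquadratic ha hb ha4 ha1 hdeg hα hβ hL hρα hρβ hτα hτβ
  have isIntegral_intCast (n : ℤ) : IsIntegral ℤ (n : L) := isIntegral_algebraMap (x := n)
  have hαi : IsIntegral ℤ α := IsIntegral.of_pow two_pos (by rw [hα]; exact isIntegral_intCast _)
  -- Clearing the denominators of `c₀, …, c₃` suffices, because `τ`, `ρ` and multiplication by `α`
  -- preserve integrality.
  have hden (k : H) : ∃ n : ℤ, n ≠ 0 ∧ n • k ∈ associatedOrder L H := by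
    obtain ⟨c₀, c₁, c₂, c₃, hc⟩ := hact k
    let n : ℤ := c₀.den * c₁.den * c₂.den * c₃.den
    have hmul (c : ℚ) (m : ℤ) (hm : n = c.den * m) : IsIntegral ℤ (n * c : L) := by
      refine isIntegral_of_eq (isIntegral_intCast (c.num * m)) ?_
      have : (n * c : ℚ) = (c.num * m : ℤ) := by
        rw [hm]
        push_cast
        linear_combination m * Rat.den_mul_eq_num c
      exact_mod_cast congrArg (Rat.cast (K := L)) this
    have h₀ := hmul c₀ (c₁.den * c₂.den * c₃.den) (by simp only [n]; ring)
    have h₁ := hmul c₁ (c₀.den * c₂.den * c₃.den) (by simp only [n]; ring)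
    have h₂ := hmul c₂ (c₀.den * c₁.den * c₃.den) (by simp only [n]; ring)
    have h₃ := hmul c₃ (c₀.den * c₁.den * c₂.den) (by simp only [n]; ring)
    refine ⟨n, by simp [n], fun x (hx : IsIntegral ℤ x) => ?_⟩
    have hτx := isIntegral_apply τ hx
    have hρx := isIntegral_apply ρ hx
    have hρτx := isIntegral_apply ρ hτx
    refine isIntegral_of_eq ((((h₀.mul hx).add (h₁.mul hτx)).add (h₂.mul (hρx.add hρτx))).add
      ((h₃.mul hαi).mul (hρx.sub hρτx))) ?_
    rw [smul_assoc, hc, zsmul_eq_mul]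
    ring
  obtain ⟨x, hx, hgen⟩ := exists_generator_of_free hden hfree
  have hs : ∃ s : ℚ, IsBiquadratic.IsLattice β γ τ s := by
    have hb4 : ¬ (4 : ℤ) ∣ d * f := fun h4 => by
      have := hb 2 (by simpa using h4)
      revert this
      decide
    have : (d * f) % 4 = 1 ∨ (d * f) % 4 = 2 ∨ (d * f) % 4 = 3 := by omega
    rcases this with h' | h' | h'
    · exact ⟨1, h.isLattice_of_modEq_one h'⟩
    · exact ⟨2, h.isLattice_of_modEq_two_or_three (.inl h')⟩
    · exact ⟨2, h.isLattice_of_modEq_two_or_three (.inr h')⟩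
  obtain ⟨s, hs⟩ := hs
  refine h.not_generated ha1 hs hx fun y hy => ?_
  obtain ⟨k, hk, rfl⟩ := hgen y hy
  obtain ⟨c₀, c₁, c₂, c₃, hc⟩ := hact k
  exact ⟨fun x => k • x, c₀ - c₁, 2 * c₃, rfl, hk, h.sub_τ_of_smul_eq hc⟩
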